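/- Let $f:\mathbb R^d\to\mathbb R$ be differentiable and let $\|\cdot\|$ be the Euclidean norm. Assume: (Linear growth) for some $L\ge 0$, $\|\nabla f(\theta)\|\le L(1+\|\theta\|)$ for all $\theta\in\mathbb R^d$. (Dissipativity) for some $\alpha,\beta>0$, $\langle\theta,\nabla f(\theta)\rangle\ge\alpha\|\theta\|^2-\beta$ for all $\theta\in\mathbb R^d$. (Noise) $\{\xi_k\}_{k\ge1}$ are i.i.d. measurable random fields on $\mathbb R^d$ with values in $\mathbb R^d$, and for some $L_\xi>0$ and all $\theta$: $\mathbb E[\xi_1(\theta)]=0$, $\mathbb E[\|\xi_1(\theta)\|^2]^{1/2}\le L_\xi(1+\|\theta\|)$ and $\mathbb E[\|\xi_1(\theta)\|^4]\le L_\xi(1+\|\theta\|^4)$. Moreover, for each $\theta$ the law of $\xi_1(\theta)$ is a sum $\mu_{1,\theta}+\mu_{2,\theta}$ of measures, where $\mu_{1,\theta}$ has a Lebesgue density $p_\theta$, and $\inf_{\theta\in C}p_\theta(t)>0$ for every bounded set $C$ and every $t\in\mathbb R^d$. For a step size $\eta>0$ and a fixed $\theta_0\in\mathbb R^d$ let $\theta^{(\eta)}_0=\theta_0$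 and $\theta^{(\eta)}_{k+1}=\theta^{(\eta)}_k-\eta\bigl(\nabla f(\theta^{(\eta)}_k)+\xi_{k+1}(\theta^{(\eta)}_k)\bigr)$ for $k\ge0$. Let $\theta^*$ be any critical point of $f$, that is, $\nabla f(\theta^*)=0$, and put $\bar L:=L(1+\|\theta^*\|)$, $$L_\dagger:=\bar L^2+16\Bigl(L_\xi^{3/4}\bigl(1+(\beta/\alpha)^3\bigr)\vee L_\xi^{1/2}\bigl(1+(\beta/\alpha)^2\bigr)\vee L_\xi\bigl(1+(\beta/\alpha)^4\bigr)\Bigr),$$ $$c_{L,\alpha}:=\frac{\alpha-\sqrt{(\alpha^2-(3L^2+L_\xi))\vee0}}{3L^2+L_\xi},\qquad c^\dagger_{L,\alpha}:=\frac{\alpha-\sqrt{(\alpha^2-16L_\dagger)\vee0}}{64L_\dagger}.$$ Suppose $0<\eta<1\wedge\frac1{10\bar L}\wedge c_{L,\alpha}\wedge c^\dagger_{L,\alpha}$. Then $\rho:=\sqrt{1-2\alpha\eta+32L_\dagger\eta^2}\in(0,1)$, and for every $\theta_0\in\mathbb R^d$ and every $k\ge0$ $$\mathbb E\bigl[\|\theta^{(\eta)}_k-\theta^*\|^4\bigr]^{1/2}\le\rho^k\,\|\theta_0-\theta^*\|^2+D,$$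 where $$\begin{aligned}D:={}&\frac{64}{\alpha}\Bigl(\bar L^4+L_\xi\bigl(1+(\beta/\alpha)^4\bigr)+512\bar L^6+23L_\xi^{3/2}\bigl(1+(\beta/\alpha)^6\bigr)\Bigr)^{1/2}\\&\vee\frac8\alpha\Bigl(\beta+\bigl(\sqrt\alpha+2L/\sqrt\alpha\bigr)^2\|\theta^*\|^2+L\|\theta^*\|+6\bar L^2+9L_\xi^{1/2}\bigl(1+(\beta/\alpha)^2\bigr)+16\Bigr).\end{aligned}$$ Consequently, for every stationary distribution $\pi_\eta$ of the Markov chain $(\theta^{(\eta)}_k)_{k\ge0}$ and every $L_\phi$-Lipschitz $\phi:\mathbb R^d\to\mathbb R$, $\phi$ is $\pi_\eta$-integrable and, with $\pi_\eta(\phi)=\int\phi\,d\pi_\eta$, $$|\pi_\eta(\phi)-\phi(\theta^*)|\le L_\phi\sqrt D.$$ -/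

import Mathlib

open MeasureTheory ProbabilityTheory

noncomputable section

namespace SGD

/-- The parameter space `ℝ^d` with its Euclidean norm. -/
abbrev Param (d : ℕ) : Type := EuclideanSpace ℝ (Fin d)

/-- The gradient of `f` grows at most linearly, with constant `L ≥ 0`. -/
def LinearGrowth {d : ℕ} (f : Param d → ℝ) (L : ℝ) : Prop :=
  0 ≤ L ∧ ∀ θ, ‖gradient f θ‖ ≤ L * (1 + ‖θ‖)

/-- `f` is `(α, β)`-dissipative, with `α, β > 0`. -/
def Dissipative {d : ℕ} (f : Param d → ℝ) (α β : ℝ) : Prop :=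
  0 < α ∧ 0 < β ∧ ∀ θ, α * ‖θ‖ ^ 2 - β ≤ inner ℝ θ (gradient f θ)

section Noise

variable {d : ℕ} {Ω : Type*} [mΩ : MeasurableSpace Ω]

/-- The random fields `ξ k : θ ↦ ξ k · θ` are i.i.d. and measurable: the `k`-th one is jointly
measurable with respect to a σ-algebra `𝒢 k` of events (its source of randomness) and the Borel
sets of `ℝ^d`, the σ-algebras `𝒢 k` are independent, and all fields have the same law
(as random functions, with the product σ-algebra, i.e. the same finite-dimensional laws).
Joint measurability with respect to `𝒢 k` is what makes a field independent of the others
also when it is evaluated at a random point that depends on the others. -/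
structure IIDRandomFields (P : Measure Ω) (ξ : ℕ → Ω → Param d → Param d) : Prop where
  indep : ∃ 𝒢 : ℕ → MeasurableSpace Ω,
    (∀ k, 𝒢 k ≤ mΩ) ∧
    iIndep 𝒢 P ∧
    ∀ k, Measurable[(𝒢 k).prod inferInstance]
      (fun p : Ω × Param d => ξ k p.1 p.2)
  identDistrib : ∀ k, IdentDistrib (ξ k) (ξ 0) P P

/-- The noise assumption: i.i.d. centred random fields, whose `L²` norm grows at most linearly,
and whose law at each `θ` splits as `μ₁ + μ₂`, where `μ₁` has a Lebesgue density `p θ` with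
`inf_{θ ∈ C} p θ t > 0` for all bounded `C` and all `t`. The field used in the step from time `k`
to time `k + 1` is `ξ k`. -/
structure NoiseAssumption (P : Measure Ω) (ξ : ℕ → Ω → Param d → Param d) (Lξ : ℝ) : Prop where
  pos : 0 < Lξ
  iid : IIDRandomFields P ξ
  memLp_two : ∀ θ, MemLp (fun ω => ξ 0 ω θ) 2 P
  mean_zero : ∀ θ, ∫ ω, ξ 0 ω θ ∂P = 0
  second_moment : ∀ θ, Real.sqrt (∫ ω, ‖ξ 0 ω θ‖ ^ 2 ∂P) ≤ Lξ * (1 + ‖θ‖)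
  density : ∃ p : Param d → Param d → ENNReal,
    (∀ θ, Measurable (p θ)) ∧
    (∀ θ, ∃ μ₂ : Measure (Param d),
      P.map (fun ω => ξ 0 ω θ) = volume.withDensity (p θ) + μ₂) ∧
    ∀ C : Set (Param d), Bornology.IsBounded C → ∀ t, 0 < ⨅ θ ∈ C, p θ t

/-- The noise assumption, strengthened by a bound on the fourth moment with the same constant. -/
structure NoiseAssumptionFour (P : Measure Ω) (ξ : ℕ → Ω → Param d → Param d) (Lξ : ℝ) : Prop
    extends NoiseAssumption P ξ Lξ where
  memLp_four : ∀ θ, MemLp (fun ω => ξ 0 ω θ) 4 P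
  fourth_moment : ∀ θ, ∫ ω, ‖ξ 0 ω θ‖ ^ 4 ∂P ≤ Lξ * (1 + ‖θ‖ ^ 4)

/-- The SGD iterates with constant step size `η`, started at `θ₀`:
`θ_{k+1} = θ_k - η (∇f(θ_k) + ξ_{k+1}(θ_k))`, where `ξ_{k+1}` is the field `ξ k`. -/
def iterate (f : Param d → ℝ) (ξ : ℕ → Ω → Param d → Param d) (η : ℝ) (θ₀ : Param d) :
    ℕ → Ω → Param d
  | 0, _ => θ₀
  | k + 1, ω =>
    iterate f ξ η θ₀ k ω
      - η • (gradient f (iterate f ξ η θ₀ k ω) + ξ k ω (iterate f ξ η θ₀ k ω))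

/-- The transition probability of the SGD chain: the law of `θ - η (∇f(θ) + ξ(θ))`,
where `ξ` has the common law of the noise fields. -/
def transition (P : Measure Ω) (f : Param d → ℝ) (ξ : ℕ → Ω → Param d → Param d) (η : ℝ)
    (θ : Param d) : Measure (Param d) :=
  P.map (fun ω => θ - η • (gradient f θ + ξ 0 ω θ))

/-- `π` is a stationary distribution of the SGD chain: a probability measure with
`∫ P(θ, A) π(dθ) = π(A)` for every Borel set `A`. -/
structure IsStationary (P : Measure Ω) (f : Param d → ℝ) (ξ : ℕ → Ω → Param d → Param d) (η : ℝ)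
    (π : Measure (Param d)) : Prop where
  prob : IsProbabilityMeasure π
  invariant : ∀ A, MeasurableSet A → ∫⁻ θ, transition P f ξ η θ A ∂π = π A

end Noise

/-- `L̄ = L (1 + ‖θ*‖)`; the argument `r` stands for `‖θ*‖`. -/
def Lbar (L r : ℝ) : ℝ := L * (1 + r)

/-- The constant `c_{L,α}`. -/
def cL (α L Lξ : ℝ) : ℝ :=
  (α - Real.sqrt (max (α ^ 2 - (3 * L ^ 2 + Lξ)) 0)) / (3 * L ^ 2 + Lξ)

/-- The constant `L_†`; `r` stands for `‖θ*‖`. -/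
def Ldagger (α β L Lξ r : ℝ) : ℝ :=
  Lbar L r ^ 2 + 16 *
    max (max (Lξ ^ (3 / 4 : ℝ) * (1 + (β / α) ^ 3)) (Lξ ^ (1 / 2 : ℝ) * (1 + (β / α) ^ 2)))
      (Lξ * (1 + (β / α) ^ 4))

/-- The constant `c_{L,α}^†`; `r` stands for `‖θ*‖`. -/
def cDagger (α β L Lξ r : ℝ) : ℝ :=
  (α - Real.sqrt (max (α ^ 2 - 16 * Ldagger α β L Lξ r) 0)) / (64 * Ldagger α β L Lξ r)

/-- The constant `D`; `r` stands for `‖θ*‖`. -/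
def constD (α β L Lξ r : ℝ) : ℝ :=
  max
    (64 / α * Real.sqrt
      (Lbar L r ^ 4 + Lξ * (1 + (β / α) ^ 4) + 512 * Lbar L r ^ 6
        + 23 * Lξ ^ (3 / 2 : ℝ) * (1 + (β / α) ^ 6)))
    (8 / α *
      (β + (Real.sqrt α + 2 * L / Real.sqrt α) ^ 2 * r ^ 2 + L * r + 6 * Lbar L r ^ 2
        + 9 * Lξ ^ (1 / 2 : ℝ) * (1 + (β / α) ^ 2) + 16))

/-- The contraction factor `ρ`; `r` stands for `‖θ*‖`. -/
def rate (α β L Lξ r η : ℝ) : ℝ :=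
  Real.sqrt (1 - 2 * α * η + 32 * Ldagger α β L Lξ r * η ^ 2)

end SGD

end

namespace SGD

lemma Ldagger_lower {α β L Lξ r : ℝ} (hLξ : 0 < Lξ) :
    0 < Ldagger α β L Lξ r ∧
      ∃ m, √Lξ ≤ m ∧ Lξ ≤ m ∧ Ldagger α β L Lξ r = Lbar L r ^ 2 + 16 * m := by
  have h1 : Lξ ≤ Lξ * (1 + (β / α) ^ 4) :=
    le_mul_of_one_le_right hLξ.le (by nlinarith [sq_nonneg ((β / α) ^ 2)])
  have h2 : √Lξ ≤ Lξ ^ (1 / 2 : ℝ) * (1 + (β / α) ^ 2) := by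
    rw [← Real.sqrt_eq_rpow]
    exact le_mul_of_one_le_right (Real.sqrt_nonneg _) (by nlinarith [sq_nonneg (β / α)])
  have h3 : Lξ ≤ max (max (Lξ ^ (3 / 4 : ℝ) * (1 + (β / α) ^ 3))
      (Lξ ^ (1 / 2 : ℝ) * (1 + (β / α) ^ 2))) (Lξ * (1 + (β / α) ^ 4)) :=
    h1.trans (le_max_right _ _)
  refine ⟨?_, _, h2.trans ((le_max_right _ _).trans (le_max_left _ _)), h3, rfl⟩
  unfold Ldagger
  nlinarith [sq_nonneg (Lbar L r)]

lemma step_size_bounds {α β L Lξ r η : ℝ} (hα : 0 < α) (hLξ : 0 < Lξ)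
    (hη : η < cDagger α β L Lξ r) :
    α * η < 1 / 4 ∧ 64 * Ldagger α β L Lξ r * η < α := by
  obtain ⟨hK, -⟩ := Ldagger_lower (α := α) (β := β) (L := L) (r := r) hLξ
  unfold cDagger at hη
  generalize Ldagger α β L Lξ r = K at *
  rw [lt_div_iff₀ (by positivity)] at hη
  have hs0 := Real.sqrt_nonneg (max (α ^ 2 - 16 * K) 0)
  have hs := Real.sq_sqrt (le_max_right (α ^ 2 - 16 * K) 0)
  have hm := le_max_left (α ^ 2 - 16 * K) 0
  have hm2 : max (α ^ 2 - 16 * K) 0 ≤ α ^ 2 := max_le (by linarith) (by positivity)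
  have hsα : √(max (α ^ 2 - 16 * K) 0) ≤ α := (Real.sqrt_le_left hα.le).2 hm2
  generalize √(max (α ^ 2 - 16 * K) 0) = s at *
  constructor
  · have h1 : α * (η * (64 * K)) < α * (α - s) := by gcongr
    have h2 : 0 ≤ s * (α - s) := by
      exact mul_nonneg hs0 (sub_nonneg.2 hsα)
    nlinarith
  · linarith

/-- The contraction factor and what the proof needs to know about its distance to `1`. -/
lemma rate_bounds {α β L Lξ r η : ℝ} (hα : 0 < α) (hLξ : 0 < Lξ) (hη0 : 0 < η)
    (hη : η < cDagger α β L Lξ r) :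
    rate α β L Lξ r η ^ 2 = 1 - 2 * α * η + 32 * Ldagger α β L Lξ r * η ^ 2 ∧
    1 / 2 ≤ rate α β L Lξ r η ∧ 3 / 4 * α * η ≤ 1 - rate α β L Lξ r η := by
  obtain ⟨hK, -⟩ := Ldagger_lower (α := α) (β := β) (L := L) (r := r) hLξ
  obtain ⟨h1, h2⟩ := step_size_bounds hα hLξ hη
  unfold rate
  generalize Ldagger α β L Lξ r = K at *
  have hKη : 0 ≤ 32 * K * η ^ 2 := by positivity
  have hKη' : 32 * K * η ^ 2 ≤ α * η / 2 := by nlinarith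
  have hlow : 1 / 2 ≤ 1 - 2 * α * η + 32 * K * η ^ 2 := by nlinarith
  have hsq := Real.sq_sqrt (show 0 ≤ 1 - 2 * α * η + 32 * K * η ^ 2 by linarith)
  have h0 := Real.sqrt_nonneg (1 - 2 * α * η + 32 * K * η ^ 2)
  generalize √(1 - 2 * α * η + 32 * K * η ^ 2) = ρ at *
  refine ⟨hsq, by nlinarith, ?_⟩
  have : ρ ≤ 1 := by nlinarith [mul_pos hα hη0]
  nlinarith [sq_nonneg (1 - ρ)]

/-- Dissipativity, recentred at a point of norm `r`. -/
lemma recentred_dissipativity {α β L r N p n : ℝ} (hα : 0 < α) (hL : 0 ≤ L)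
    (hn0 : 0 ≤ n) (hn : n ≤ N + r) (hp : α * N ^ 2 - β - r * (L * (1 + N)) ≤ p) :
    α / 2 * n ^ 2 - (β + (√α + 2 * L / √α) ^ 2 * r ^ 2 + L * r) ≤ p := by
  have hs : 0 < √α := Real.sqrt_pos.2 hα
  have hsq := Real.sq_sqrt hα.le
  have e : (√α + 2 * L / √α) ^ 2 = α + 4 * L + 4 * (L ^ 2 / α) := by
    rw [add_sq, div_pow, hsq]
    field_simp
    ring
  obtain ⟨q, hq⟩ : ∃ q, q = L / α := ⟨_, rfl⟩
  have hLq : L = α * q := by rw [hq]; field_simp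
  have e2 : L ^ 2 / α = α * q ^ 2 := by rw [hLq]; field_simp
  have hq0 : 0 ≤ q := by rw [hq]; positivity
  rw [e, e2]
  have hn2 : n ^ 2 ≤ (N + r) ^ 2 := by gcongr
  have hn3 : α / 2 * n ^ 2 ≤ α / 2 * (N + r) ^ 2 := by gcongr
  have h1 : 0 ≤ α * (N - r - q * r) ^ 2 := by positivity
  have h2 : 0 ≤ α * (q * r ^ 2) := by positivity
  have h3 : 0 ≤ α * (q ^ 2 * r ^ 2) := by positivity
  rw [hLq] at hp ⊢
  nlinarith

lemma constD_nonneg (α β L Lξ r : ℝ) (hα : 0 < α) : 0 ≤ constD α β L Lξ r :=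
  le_max_of_le_left (by positivity)

/-- The scalar inequality behind the one-step contraction: `n` is the distance to the critical
point, `N` the norm of the current point, `G` the norm of the gradient, `p` the inner product of
the displacement with the gradient, `S₂` and `S₄` the moments of the noise. -/
lemma one_step_scalar {α β L Lξ r η n N G p S₂ S₄ : ℝ} (hα : 0 < α) (hβ : 0 < β) (hL : 0 ≤ L)
    (hLξ : 0 < Lξ) (hr : 0 ≤ r) (hrβ : α * r ^ 2 ≤ β) (hη0 : 0 < η) (hη1 : η < 1)
    (hηL : η * Lbar L r ≤ 1 / 10) (hηc : η < cDagger α β L Lξ r) (hN : 0 ≤ N)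
    (hNn : N ≤ r + n) (hG : 0 ≤ G) (hGn : G ≤ Lbar L r * (1 + n))
    (hp : α / 2 * n ^ 2 - (β + (√α + 2 * L / √α) ^ 2 * r ^ 2 + L * r) ≤ p)
    (hS₂ : S₂ ≤ √Lξ * (1 + N ^ 2)) (hS₄ : S₄ ≤ Lξ * (1 + N ^ 4)) :
    (n ^ 2) ^ 2 - 4 * η * n ^ 2 * p + 8 * η ^ 2 * n ^ 2 * (G ^ 2 + S₂)
        + 24 * η ^ 4 * (G ^ 4 + S₄)
      ≤ (rate α β L Lξ r η * n ^ 2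
          + (1 - rate α β L Lξ r η) * constD α β L Lξ r) ^ 2 := by
  obtain ⟨hρ2, hρlow, hρup⟩ := rate_bounds (L := L) (β := β) (r := r) hα hLξ hη0 hηc
  obtain ⟨-, m, hm1, hm2, hm⟩ := Ldagger_lower (α := α) (β := β) (L := L) (r := r) hLξ
  have hB0 : 0 ≤ β + (√α + 2 * L / √α) ^ 2 * r ^ 2 + L * r := by positivity
  have hLb : 0 ≤ Lbar L r := by unfold Lbar; positivity
  have hrx : r ^ 2 ≤ β / α := by rw [le_div_iff₀ hα]; linarith
  have hx : 0 ≤ β / α := by positivity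
  have hz : 0 ≤ √Lξ := Real.sqrt_nonneg _
  have hD0 := constD_nonneg α β L Lξ r hα
  have hD1 : 8 * (β + (√α + 2 * L / √α) ^ 2 * r ^ 2 + L * r + 6 * Lbar L r ^ 2
      + 9 * √Lξ * (1 + (β / α) ^ 2) + 16) ≤ α * constD α β L Lξ r := by
    rw [← div_le_iff₀' hα, Real.sqrt_eq_rpow Lξ, mul_div_right_comm]
    exact le_max_right _ _
  have hD2 : 4096 * (Lbar L r ^ 4 + Lξ * (1 + (β / α) ^ 4)) ≤ (α * constD α β L Lξ r) ^ 2 := by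
    have hQ : Lbar L r ^ 4 + Lξ * (1 + (β / α) ^ 4) ≤ Lbar L r ^ 4 + Lξ * (1 + (β / α) ^ 4)
        + 512 * Lbar L r ^ 6 + 23 * Lξ ^ (3 / 2 : ℝ) * (1 + (β / α) ^ 6) := by
      have : 0 ≤ 23 * Lξ ^ (3 / 2 : ℝ) * (1 + (β / α) ^ 6) := by positivity
      have : 0 ≤ 512 * Lbar L r ^ 6 := by positivity
      linarith
    have h0 : 64 * √(Lbar L r ^ 4 + Lξ * (1 + (β / α) ^ 4)) ≤ α * constD α β L Lξ r := by
      rw [← div_le_iff₀' hα, mul_div_right_comm]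
      exact le_max_of_le_left (by gcongr)
    have h1 := Real.sq_sqrt (show 0 ≤ Lbar L r ^ 4 + Lξ * (1 + (β / α) ^ 4) by positivity)
    have h2 := pow_le_pow_left₀ (by positivity) h0 2
    rw [mul_pow, h1] at h2
    linarith
  generalize rate α β L Lξ r η = ρ at *
  generalize constD α β L Lξ r = D at *
  generalize β + (√α + 2 * L / √α) ^ 2 * r ^ 2 + L * r = B at *
  rw [hm] at hρ2
  generalize Lbar L r = K at *
  generalize β / α = x at *
  generalize √Lξ = z at *
  have hN2 : N ^ 2 ≤ 2 * x + 2 * n ^ 2 := by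
    have : N ^ 2 ≤ (r + n) ^ 2 := by gcongr
    linarith [sq_nonneg (r - n)]
  obtain ⟨u, hu⟩ : ∃ u, u = n ^ 2 := ⟨_, rfl⟩
  have hu0 : 0 ≤ u := hu ▸ sq_nonneg n
  have hG2 : G ^ 2 ≤ 2 * K ^ 2 * (1 + u) := by
    have : G ^ 2 ≤ (K * (1 + n)) ^ 2 := by gcongr
    rw [hu]
    linarith [mul_nonneg (sq_nonneg K) (sq_nonneg (1 - n))]
  have hG4 : G ^ 4 ≤ 8 * K ^ 4 * (1 + u ^ 2) := by
    have h : (G ^ 2) ^ 2 ≤ (2 * K ^ 2 * (1 + u)) ^ 2 := by gcongr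
    linarith [mul_nonneg (sq_nonneg (K ^ 2)) (sq_nonneg (1 - u))]
  rw [← hu] at hN2 hp ⊢
  have hN4 : N ^ 4 ≤ 8 * x ^ 2 + 8 * u ^ 2 := by
    have : (N ^ 2) ^ 2 ≤ (2 * x + 2 * u) ^ 2 := by gcongr
    linarith [sq_nonneg (x - u)]
  have hS2' : S₂ ≤ 2 * z * (1 + x ^ 2) + 2 * m * u := by
    have h1 : z * (1 + N ^ 2) ≤ z * (1 + (2 * x + 2 * u)) := by gcongr
    have h2 : z * u ≤ m * u := by gcongr
    linarith [mul_nonneg hz (sq_nonneg (x - 1)), mul_nonneg hz (sq_nonneg x)]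
  have hS4' : S₄ ≤ 5 * (Lξ * (1 + x ^ 4)) + 8 * m * u ^ 2 := by
    have h1 : Lξ * (1 + N ^ 4) ≤ Lξ * (1 + (8 * x ^ 2 + 8 * u ^ 2)) := by gcongr
    have h2 : Lξ * u ^ 2 ≤ m * u ^ 2 := by gcongr
    linarith [mul_nonneg hLξ.le (sq_nonneg (x ^ 2 - 1)), mul_nonneg hLξ.le (sq_nonneg (x ^ 2))]
  have hm0 : 0 ≤ m := hz.trans hm1
  have hη2 : η ^ 2 ≤ η := pow_le_of_le_one hη0.le hη1.le two_ne_zero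
  have hη4 : η ^ 4 ≤ η ^ 2 := pow_le_pow_of_le_one hη0.le hη1.le (by norm_num)
  have hηK : η ^ 4 * K ^ 4 ≤ 1 / 100 * (η ^ 2 * K ^ 2) := by
    have : (η * K) ^ 2 ≤ (1 / 10) ^ 2 := by gcongr
    linarith [mul_le_mul_of_nonneg_right this (sq_nonneg (η * K))]
  have t1 : -(4 * η * u * p) ≤ -(2 * α * η * u ^ 2) + 4 * η * u * B := by
    have := mul_le_mul_of_nonneg_left hp (show 0 ≤ 4 * η * u by positivity)
    linarith
  have t2 : 8 * η ^ 2 * u * (G ^ 2 + S₂) ≤ 16 * (η ^ 2 * K ^ 2) * u ^ 2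
      + 16 * η ^ 2 * m * u ^ 2 + η * u * (16 * K ^ 2 + 16 * z * (1 + x ^ 2)) := by
    have h1 := mul_le_mul_of_nonneg_left (add_le_add hG2 hS2')
      (show 0 ≤ 8 * η ^ 2 * u by positivity)
    have h2 := mul_le_mul_of_nonneg_right hη2
      (show 0 ≤ u * (16 * K ^ 2 + 16 * z * (1 + x ^ 2)) by positivity)
    linarith
  have t3 : 24 * η ^ 4 * (G ^ 4 + S₄) ≤ 2 * (η ^ 2 * K ^ 2) * u ^ 2
      + 192 * η ^ 2 * m * u ^ 2 + η ^ 2 * (192 * (K ^ 4 + Lξ * (1 + x ^ 4))) := by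
    have h1 := mul_le_mul_of_nonneg_left (add_le_add hG4 hS4')
      (show 0 ≤ 24 * η ^ 4 by positivity)
    have h2 := mul_le_mul_of_nonneg_right hη4
      (show 0 ≤ 192 * (K ^ 4 + Lξ * (1 + x ^ 4)) + 192 * m * u ^ 2 by positivity)
    have h3 := mul_le_mul_of_nonneg_right hηK (show 0 ≤ 192 * u ^ 2 by positivity)
    have h4 : 0 ≤ η ^ 4 * (Lξ * (1 + x ^ 4)) := by positivity
    have h5 : 0 ≤ η ^ 2 * K ^ 2 * u ^ 2 := by positivity
    linarith
  have c1 : η * (4 * B + 16 * K ^ 2 + 16 * z * (1 + x ^ 2)) ≤ 2 * ρ * (1 - ρ) * D := by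
    have h1 : 1 / 2 * (3 / 4 * α * η) ≤ ρ * (1 - ρ) := by
      gcongr
    have h2 := mul_le_mul_of_nonneg_right h1 hD0
    have h3 := mul_le_mul_of_nonneg_left hD1 hη0.le
    have h4 : 0 ≤ η * (z * (1 + x ^ 2)) := by positivity
    have h5 : 0 ≤ η * K ^ 2 := by positivity
    have h6 : 0 ≤ η * B := by positivity
    linarith
  have c2 : η ^ 2 * (192 * (K ^ 4 + Lξ * (1 + x ^ 4))) ≤ (1 - ρ) ^ 2 * D ^ 2 := by
    have h1 : (3 / 4 * α * η) ^ 2 ≤ (1 - ρ) ^ 2 := by gcongr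
    have h2 := mul_le_mul_of_nonneg_right h1 (sq_nonneg D)
    have h3 := mul_le_mul_of_nonneg_left hD2 (sq_nonneg η)
    have h4 : 0 ≤ η ^ 2 * (K ^ 4 + Lξ * (1 + x ^ 4)) := by positivity
    linarith
  have c3 := mul_le_mul_of_nonneg_right c1 hu0
  have c4 : 0 ≤ η ^ 2 * K ^ 2 * u ^ 2 := by positivity
  have c5 : 0 ≤ η ^ 2 * m * u ^ 2 := by positivity
  have e : (ρ * u + (1 - ρ) * D) ^ 2 = (1 - 2 * α * η + 32 * (K ^ 2 + 16 * m) * η ^ 2) * u ^ 2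
      + 2 * ρ * (1 - ρ) * D * u + (1 - ρ) ^ 2 * D ^ 2 := by
    rw [← hρ2]; ring
  rw [e]
  linarith

/-- A fourth power of a norm, expanded so that the noise `v` enters linearly or in norm. -/
lemma norm_sub_smul_add_pow_four_le {E : Type*} [NormedAddCommGroup E] [InnerProductSpace ℝ E]
    (x g v : E) (η : ℝ) :
    ‖x - η • (g + v)‖ ^ 4 ≤
      ((‖x‖ ^ 2) ^ 2 - 4 * η * ‖x‖ ^ 2 * inner ℝ x g + 8 * η ^ 2 * ‖x‖ ^ 2 * ‖g‖ ^ 2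
          + 24 * η ^ 4 * ‖g‖ ^ 4)
        + inner ℝ ((-(4 * η * ‖x‖ ^ 2)) • x + (16 * η ^ 2 * ‖x‖ ^ 2) • g) v
        + 8 * η ^ 2 * ‖x‖ ^ 2 * ‖v‖ ^ 2 + 24 * η ^ 4 * ‖v‖ ^ 4 := by
  have e1 : ‖x - η • (g + v)‖ ^ 2 =
      ‖x‖ ^ 2 - 2 * (η * (inner ℝ x g + inner ℝ x v)) + η ^ 2 * ‖g + v‖ ^ 2 := by
    rw [norm_sub_sq_real, inner_smul_right, inner_add_right, norm_smul, mul_pow,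
      Real.norm_eq_abs, sq_abs]
  have e2 := norm_add_sq_real g v
  have hcs : (inner ℝ x g + inner ℝ x v) ^ 2 ≤ ‖x‖ ^ 2 * ‖g + v‖ ^ 2 := by
    rw [← inner_add_right, ← sq_abs, ← mul_pow]
    exact pow_le_pow_left₀ (abs_nonneg _) (abs_real_inner_le_norm _ _) 2
  have h4 : (‖g + v‖ ^ 2) ^ 2 ≤ 8 * ‖g‖ ^ 4 + 8 * ‖v‖ ^ 4 := by
    have h1 : ‖g + v‖ ^ 2 ≤ 2 * ‖g‖ ^ 2 + 2 * ‖v‖ ^ 2 := by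
      have := pow_le_pow_left₀ (norm_nonneg _) (norm_add_le g v) 2
      linarith [sq_nonneg (‖g‖ - ‖v‖)]
    have := pow_le_pow_left₀ (by positivity) h1 2
    linarith [sq_nonneg (‖g‖ ^ 2 - ‖v‖ ^ 2)]
  rw [show ‖x - η • (g + v)‖ ^ 4 = (‖x - η • (g + v)‖ ^ 2) ^ 2 by ring, e1, inner_add_left,
    inner_smul_left, inner_smul_left]
  simp only [conj_trivial]
  generalize ‖g + v‖ ^ 2 = q at *
  generalize inner ℝ x g = a at *
  generalize inner ℝ x v = b at *
  generalize inner ℝ g v = c at *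
  generalize ‖x‖ ^ 2 = u at *
  have t1 := mul_le_mul_of_nonneg_left hcs (show 0 ≤ 6 * η ^ 2 by positivity)
  have t2 := mul_le_mul_of_nonneg_left h4 (show 0 ≤ 3 * η ^ 4 by positivity)
  have t3 := sq_nonneg (η * (a + b) + η ^ 2 * q)
  have t4 : η ^ 2 * u * q = η ^ 2 * u * (‖g‖ ^ 2 + 2 * c + ‖v‖ ^ 2) := by rw [e2]
  linarith

lemma integral_affine_combination {Ω : Type*} [MeasurableSpace Ω] (P : Measure Ω)
    [IsProbabilityMeasure P] {X Y Z : Ω → ℝ} (hX : Integrable X P) (hY : Integrable Y P)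
    (hZ : Integrable Z P) (c a b : ℝ) :
    Integrable (fun ω => c + X ω + a * Y ω + b * Z ω) P ∧
    ∫ ω, (c + X ω + a * Y ω + b * Z ω) ∂P
      = c + ∫ ω, X ω ∂P + a * ∫ ω, Y ω ∂P + b * ∫ ω, Z ω ∂P := by
  have h0 : Integrable (fun _ : Ω => c) P := integrable_const c
  have h1 : Integrable (fun ω => c + X ω) P := h0.add hX
  have hY' : Integrable (fun ω => a * Y ω) P := hY.const_mul a
  have h2 : Integrable (fun ω => c + X ω + a * Y ω) P := h1.add hY'
  have hZ' : Integrable (fun ω => b * Z ω) P := hZ.const_mul b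
  refine ⟨h2.add hZ', ?_⟩
  rw [integral_add h2 hZ', integral_add h1 hY', integral_add h0 hX, integral_const_mul,
    integral_const_mul, integral_const, probReal_univ, one_smul]

lemma sq_integral_le {Ω : Type*} [MeasurableSpace Ω] (P : Measure Ω) [IsProbabilityMeasure P]
    {X : Ω → ℝ} (h1 : Integrable X P) (h2 : Integrable (fun ω => X ω ^ 2) P) :
    (∫ ω, X ω ∂P) ^ 2 ≤ ∫ ω, X ω ^ 2 ∂P := by
  obtain ⟨-, e⟩ := integral_affine_combination P h2 h1 h1 ((∫ ω, X ω ∂P) ^ 2)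
    (-2 * ∫ ω, X ω ∂P) 0
  have h : 0 ≤ ∫ ω, ((∫ ω, X ω ∂P) ^ 2 + X ω ^ 2 + (-2 * ∫ ω, X ω ∂P) * X ω + 0 * X ω) ∂P :=
    integral_nonneg fun ω => by
      have := sq_nonneg (X ω - ∫ ω, X ω ∂P)
      simp only [Pi.zero_apply]
      linarith
  linarith

lemma integral_norm_sub_smul_add_pow_four_le {E : Type*} [NormedAddCommGroup E]
    [InnerProductSpace ℝ E] [CompleteSpace E] {Ω : Type*} [MeasurableSpace Ω] (P : Measure Ω)
    [IsProbabilityMeasure P] {v : Ω → E} (hv : MemLp v 4 P) (hv0 : ∫ ω, v ω ∂P = 0)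
    (x g : E) (η : ℝ) :
    Integrable (fun ω => ‖x - η • (g + v ω)‖ ^ 4) P ∧
    ∫ ω, ‖x - η • (g + v ω)‖ ^ 4 ∂P ≤
      (‖x‖ ^ 2) ^ 2 - 4 * η * ‖x‖ ^ 2 * inner ℝ x g
        + 8 * η ^ 2 * ‖x‖ ^ 2 * (‖g‖ ^ 2 + ∫ ω, ‖v ω‖ ^ 2 ∂P)
        + 24 * η ^ 4 * (‖g‖ ^ 4 + ∫ ω, ‖v ω‖ ^ 4 ∂P) := by
  have hi4 : Integrable (fun ω => ‖v ω‖ ^ 4) P := hv.integrable_norm_pow four_ne_zero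
  have hv2 : MemLp v 2 P := hv.mono_exponent (by norm_num)
  have hi2 : Integrable (fun ω => ‖v ω‖ ^ 2) P := hv2.integrable_norm_pow two_ne_zero
  have hi1 : Integrable v P := hv2.integrable one_le_two
  have hstep : MemLp (fun ω => x - η • (g + v ω)) 4 P :=
    (memLp_const x).sub (((memLp_const g).add hv).const_smul η)
  have hint : Integrable (fun ω => ‖x - η • (g + v ω)‖ ^ 4) P :=
    hstep.integrable_norm_pow four_ne_zero
  refine ⟨hint, ?_⟩
  have hpt := fun ω => norm_sub_smul_add_pow_four_le x g (v ω) η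
  generalize (-(4 * η * ‖x‖ ^ 2)) • x + (16 * η ^ 2 * ‖x‖ ^ 2) • g = w at hpt
  have hiw : Integrable (fun ω => inner ℝ w (v ω)) P := hi1.const_inner w
  have hw : ∫ ω, inner ℝ w (v ω) ∂P = 0 := by
    rw [integral_inner hi1, hv0, inner_zero_right]
  obtain ⟨hi, he⟩ := integral_affine_combination P hiw hi2 hi4
    ((‖x‖ ^ 2) ^ 2 - 4 * η * ‖x‖ ^ 2 * inner ℝ x g + 8 * η ^ 2 * ‖x‖ ^ 2 * ‖g‖ ^ 2
      + 24 * η ^ 4 * ‖g‖ ^ 4) (8 * η ^ 2 * ‖x‖ ^ 2) (24 * η ^ 4)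
  refine (integral_mono hint hi hpt).trans ?_
  rw [he, hw]
  linarith

section OneStep

variable {d : ℕ} {Ω : Type*} [MeasurableSpace Ω] {P : Measure Ω} [IsProbabilityMeasure P]

lemma norm_sq_critical_le {f : Param d → ℝ} {α β : ℝ} (hdiss : Dissipative f α β) {θs : Param d}
    (hcrit : gradient f θs = 0) : α * ‖θs‖ ^ 2 ≤ β := by
  have := hdiss.2.2 θs
  rw [hcrit, inner_zero_right] at this
  linarith

lemma second_moment_le {ξ : ℕ → Ω → Param d → Param d} {Lξ : ℝ}
    (hnoise : NoiseAssumptionFour P ξ Lξ) (θ : Param d) :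
    ∫ ω, ‖ξ 0 ω θ‖ ^ 2 ∂P ≤ √Lξ * (1 + ‖θ‖ ^ 2) := by
  have hi2 := (hnoise.memLp_two θ).integrable_norm_pow two_ne_zero
  have hi4 := (hnoise.memLp_four θ).integrable_norm_pow four_ne_zero
  have e : ∀ ω, ‖ξ 0 ω θ‖ ^ 4 = (‖ξ 0 ω θ‖ ^ 2) ^ 2 := fun ω => by ring
  have h4 := hnoise.fourth_moment θ
  have hint : Integrable (fun ω => (‖ξ 0 ω θ‖ ^ 2) ^ 2) P := by
    simpa only [← e] using hi4
  have h := sq_integral_le P (by exact hi2) hint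
  simp only [← e] at h
  refine abs_le_of_sq_le_sq' ?_ (by positivity) |>.2
  rw [mul_pow, Real.sq_sqrt hnoise.pos.le]
  refine (h.trans h4).trans (mul_le_mul_of_nonneg_left ?_ hnoise.pos.le)
  nlinarith [sq_nonneg ‖θ‖]

/-- One step of the chain, started at a deterministic point. -/
lemma one_step {f : Param d → ℝ} {ξ : ℕ → Ω → Param d → Param d} {L α β Lξ : ℝ}
    (hgrowth : LinearGrowth f L) (hdiss : Dissipative f α β)
    (hnoise : NoiseAssumptionFour P ξ Lξ) {θs : Param d} (hcrit : gradient f θs = 0)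
    {η : ℝ} (hη0 : 0 < η) (hη1 : η < 1) (hηL : η * Lbar L ‖θs‖ ≤ 1 / 10)
    (hηc : η < cDagger α β L Lξ ‖θs‖) (θ : Param d) :
    Integrable (fun ω => ‖θ - η • (gradient f θ + ξ 0 ω θ) - θs‖ ^ 4) P ∧
    ∫ ω, ‖θ - η • (gradient f θ + ξ 0 ω θ) - θs‖ ^ 4 ∂P ≤
      (rate α β L Lξ ‖θs‖ η * ‖θ - θs‖ ^ 2
        + (1 - rate α β L Lξ ‖θs‖ η) * constD α β L Lξ ‖θs‖) ^ 2 := by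
  have hL := hgrowth.1
  simp only [sub_right_comm θ _ θs]
  obtain ⟨hint, hle⟩ := integral_norm_sub_smul_add_pow_four_le P (hnoise.memLp_four θ)
    (hnoise.mean_zero θ) (θ - θs) (gradient f θ) η
  refine ⟨hint, hle.trans ?_⟩
  have htri : ‖θ - θs‖ ≤ ‖θ‖ + ‖θs‖ := norm_sub_le _ _
  have htri' : ‖θ‖ ≤ ‖θs‖ + ‖θ - θs‖ := norm_le_insert' θ θs |>.trans (by rw [add_comm])
  have hg := hgrowth.2 θ
  have hdis : α / 2 * ‖θ - θs‖ ^ 2 - (β + (√α + 2 * L / √α) ^ 2 * ‖θs‖ ^ 2 + L * ‖θs‖)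
      ≤ inner ℝ (θ - θs) (gradient f θ) := by
    refine recentred_dissipativity hdiss.1 hL (norm_nonneg _) htri ?_
    have h1 : inner ℝ θs (gradient f θ) ≤ ‖θs‖ * (L * (1 + ‖θ‖)) :=
      (real_inner_le_norm _ _).trans (by gcongr)
    rw [inner_sub_left]
    linarith [hdiss.2.2 θ]
  have hgn : ‖gradient f θ‖ ≤ Lbar L ‖θs‖ * (1 + ‖θ - θs‖) := by
    refine hg.trans ?_
    unfold Lbar
    rw [mul_assoc]
    refine mul_le_mul_of_nonneg_left ?_ hL
    nlinarith [mul_nonneg (norm_nonneg θs) (norm_nonneg (θ - θs))]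
  exact one_step_scalar hdiss.1 hdiss.2.1 hL hnoise.pos (norm_nonneg θs)
    (norm_sq_critical_le hdiss hcrit) hη0 hη1 hηL hηc (norm_nonneg θ) htri' (norm_nonneg _) hgn
    hdis (second_moment_le hnoise θ) (hnoise.fourth_moment θ)

end OneStep

lemma lintegral_comp_prod_of_indepFun {Ω E F : Type*} [MeasurableSpace Ω] [MeasurableSpace E]
    [MeasurableSpace F] {P : Measure Ω} [IsProbabilityMeasure P] {X : Ω → E} {Y : Ω → F}
    (hX : Measurable X) (hY : Measurable Y) (hXY : X ⟂ᵢ[P] Y) {H : E × F → ENNReal}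
    (hH : Measurable H) :
    ∫⁻ ω, H (X ω, Y ω) ∂P = ∫⁻ ω, ∫⁻ ω', H (X ω, Y ω') ∂P ∂P := by
  have := Measure.isProbabilityMeasure_map (μ := P) hX.aemeasurable
  have := Measure.isProbabilityMeasure_map (μ := P) hY.aemeasurable
  rw [← lintegral_map hH (hX.prodMk hY),
    (indepFun_iff_map_prod_eq_prod_map_map hX.aemeasurable hY.aemeasurable).1 hXY,
    lintegral_prod _ hH.aemeasurable, lintegral_map hH.lintegral_prod_right' hX]
  exact lintegral_congr fun ω => lintegral_map (hH.comp measurable_prodMk_left) hY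

/-- A random variable measurable for one σ-algebra can be frozen when integrating a random field
measurable for an independent one. -/
lemma lintegral_comp_of_indep {Ω E : Type*} [mΩ : MeasurableSpace Ω] [mE : MeasurableSpace E]
    {P : Measure Ω} [IsProbabilityMeasure P] {m 𝒢 : MeasurableSpace Ω} (hm : m ≤ mΩ)
    (h𝒢 : 𝒢 ≤ mΩ) (hind : Indep m 𝒢 P) {X : Ω → E} (hX : Measurable[m] X)
    {H : E × Ω → ENNReal} (hH : Measurable[mE.prod 𝒢] H) :
    ∫⁻ ω, H (X ω, ω) ∂P = ∫⁻ ω, ∫⁻ ω', H (X ω, ω') ∂P ∂P := by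
  refine @lintegral_comp_prod_of_indepFun Ω E Ω mΩ mE 𝒢 P _ X id (hX.mono hm le_rfl)
    (measurable_id'' h𝒢) ?_ H hH
  rw [IndepFun_iff_Indep, MeasurableSpace.comap_id]
  exact indep_of_indep_of_le_left hind hX.comap_le

lemma measurable_gradient {d : ℕ} (f : Param d → ℝ) : Measurable (gradient f) :=
  (InnerProductSpace.toDual ℝ (Param d)).symm.continuous.measurable.comp (measurable_fderiv ℝ f)

lemma measurable_iterate {d : ℕ} {Ω : Type*} {f : Param d → ℝ} {ξ : ℕ → Ω → Param d → Param d}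
    {𝒢 : ℕ → MeasurableSpace Ω}
    (hξ : ∀ k, Measurable[(𝒢 k).prod inferInstance] (fun p : Ω × Param d => ξ k p.1 p.2))
    (η : ℝ) (θ₀ : Param d) (k : ℕ) :
    Measurable[⨆ j ∈ Set.Iio k, 𝒢 j] (iterate f ξ η θ₀ k) := by
  induction k with
  | zero => exact @measurable_const _ _ _ (_) θ₀
  | succ k ih =>
    have hle : ⨆ j ∈ Set.Iio k, 𝒢 j ≤ ⨆ j ∈ Set.Iio (k + 1), 𝒢 j :=
      biSup_mono fun j hj => lt_trans hj (Nat.lt_succ_self k)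
    have hk : 𝒢 k ≤ ⨆ j ∈ Set.Iio (k + 1), 𝒢 j :=
      le_biSup 𝒢 (Set.mem_Iio.2 (Nat.lt_succ_self k))
    generalize ⨆ j ∈ Set.Iio (k + 1), 𝒢 j = m at hle hk ⊢
    have hX : Measurable[m] (iterate f ξ η θ₀ k) := ih.mono hle le_rfl
    have hpair : Measurable[m, (𝒢 k).prod inferInstance]
        (fun ω => (ω, iterate f ξ η θ₀ k ω)) :=
      Measurable.prodMk (measurable_id'' hk) hX
    have hN : Measurable[m] (fun ω => ξ k ω (iterate f ξ η θ₀ k ω)) := (hξ k).comp hpair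
    exact hX.sub ((((measurable_gradient f).comp hX).add hN).const_smul η)

section Iterates

variable {d : ℕ} {Ω : Type*} [mΩ : MeasurableSpace Ω] {P : Measure Ω} [IsProbabilityMeasure P]

/-- The conditional expectation of a function of the next iterate, in integrated form. -/
lemma lintegral_iterate_succ {f : Param d → ℝ} {ξ : ℕ → Ω → Param d → Param d}
    (hξ : IIDRandomFields P ξ) (η : ℝ) (θ₀ : Param d) (k : ℕ) {V : Param d → ENNReal}
    (hV : Measurable V) :
    ∫⁻ ω, V (iterate f ξ η θ₀ (k + 1) ω) ∂P =
      ∫⁻ ω, ∫⁻ ω', V (iterate f ξ η θ₀ k ω - η • (gradient f (iterate f ξ η θ₀ k ω)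
        + ξ 0 ω' (iterate f ξ η θ₀ k ω))) ∂P ∂P := by
  obtain ⟨𝒢, h𝒢, hind, hmeas⟩ := hξ.indep
  have hind' : Indep (⨆ j ∈ Set.Iio k, 𝒢 j) (𝒢 k) P := by
    have := indep_iSup_of_disjoint h𝒢 hind (S := Set.Iio k) (T := {k}) (by simp)
    simpa only [Set.mem_singleton_iff, iSup_iSup_eq_left] using this
  have hH : Measurable[(inferInstance : MeasurableSpace (Param d)).prod (𝒢 k)]
      (fun p : Param d × Ω => V (p.1 - η • (gradient f p.1 + ξ k p.2 p.1))) := by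
    let _ := 𝒢 k
    have h1 : Measurable (fun p : Param d × Ω => ξ k p.2 p.1) :=
      (hmeas k).comp measurable_swap
    exact hV.comp (measurable_fst.sub
      ((((measurable_gradient f).comp measurable_fst).add h1).const_smul η))
  refine (lintegral_comp_of_indep (iSup₂_le fun j _ => h𝒢 j) (h𝒢 k) hind'
    (measurable_iterate hmeas η θ₀ k) hH).trans (lintegral_congr fun ω => ?_)
  generalize iterate f ξ η θ₀ k ω = θ
  have hW : Measurable (fun t : Param d => V (θ - η • (gradient f θ + t))) :=
    hV.comp (measurable_const.sub ((measurable_const.add measurable_id).const_smul η))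
  exact (((hξ.identDistrib k).comp (measurable_pi_apply θ)).comp hW).lintegral_eq

/-- The fourth moment of the iterates contracts up to a constant. -/
lemma iterate_fourth_moment {f : Param d → ℝ} {ξ : ℕ → Ω → Param d → Param d}
    (hξ : IIDRandomFields P ξ) {η ρ D : ℝ} {θs : Param d} (hρ0 : 0 ≤ ρ) (hρ1 : ρ ≤ 1) (hD : 0 ≤ D)
    (hone : ∀ θ, Integrable (fun ω => ‖θ - η • (gradient f θ + ξ 0 ω θ) - θs‖ ^ 4) P ∧
      ∫ ω, ‖θ - η • (gradient f θ + ξ 0 ω θ) - θs‖ ^ 4 ∂P ≤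
        (ρ * ‖θ - θs‖ ^ 2 + (1 - ρ) * D) ^ 2) (θ₀ : Param d) (k : ℕ) :
    Integrable (fun ω => ‖iterate f ξ η θ₀ k ω - θs‖ ^ 4) P ∧
      √(∫ ω, ‖iterate f ξ η θ₀ k ω - θs‖ ^ 4 ∂P)
        ≤ ρ ^ k * ‖θ₀ - θs‖ ^ 2 + (1 - ρ ^ k) * D := by
  obtain ⟨𝒢, h𝒢, -, hmeas⟩ := id hξ.indep
  have hm : ∀ k, Measurable (fun ω => iterate f ξ η θ₀ k ω - θs) := fun k =>
    ((measurable_iterate hmeas η θ₀ k).mono (iSup₂_le fun j _ => h𝒢 j) le_rfl).sub_const θs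
  induction k with
  | zero =>
    refine ⟨integrable_const (‖θ₀ - θs‖ ^ 4), ?_⟩
    simp only [iterate, integral_const, probReal_univ, one_smul, pow_zero, one_mul, sub_self,
      zero_mul, add_zero]
    rw [show ‖θ₀ - θs‖ ^ 4 = (‖θ₀ - θs‖ ^ 2) ^ 2 by ring, Real.sqrt_sq (by positivity)]
  | succ k ih =>
    obtain ⟨ih1, ih2⟩ := ih
    have hc : 0 ≤ (1 - ρ) * D := mul_nonneg (sub_nonneg.2 hρ1) hD
    have hV : Measurable (fun θ : Param d => ENNReal.ofReal (‖θ - θs‖ ^ 4)) :=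
      ((measurable_id.sub_const θs).norm.pow_const 4).ennreal_ofReal
    have hkey : ∫⁻ ω, ENNReal.ofReal (‖iterate f ξ η θ₀ (k + 1) ω - θs‖ ^ 4) ∂P ≤
        ∫⁻ ω, ENNReal.ofReal ((ρ * ‖iterate f ξ η θ₀ k ω - θs‖ ^ 2 + (1 - ρ) * D) ^ 2) ∂P := by
      rw [lintegral_iterate_succ hξ η θ₀ k hV]
      refine lintegral_mono fun ω => ?_
      obtain ⟨h1, h2⟩ := hone (iterate f ξ η θ₀ k ω)
      rw [← ofReal_integral_eq_lintegral_ofReal h1 (ae_of_all _ fun ω => by positivity)]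
      exact ENNReal.ofReal_le_ofReal h2
    obtain ⟨c, hc_eq⟩ : ∃ c, c = (1 - ρ) * D := ⟨_, rfl⟩
    rw [← hc_eq] at hc
    simp only [← hc_eq] at hkey
    have e4 : ∀ ω, ‖iterate f ξ η θ₀ k ω - θs‖ ^ 4 = (‖iterate f ξ η θ₀ k ω - θs‖ ^ 2) ^ 2 :=
      fun ω => by ring
    have hL2 : MemLp (fun ω => ‖iterate f ξ η θ₀ k ω - θs‖ ^ 2) 2 P := by
      rw [memLp_two_iff_integrable_sq ((hm k).norm.pow_const 2).aestronglyMeasurable]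
      simpa only [← e4] using ih1
    have hi2 := hL2.integrable one_le_two
    have hcomb := integral_affine_combination P (ih1.const_mul (ρ ^ 2)) hi2 hi2 (c ^ 2)
      (2 * ρ * c) 0
    have e5 : ∀ ω, c ^ 2 + ρ ^ 2 * ‖iterate f ξ η θ₀ k ω - θs‖ ^ 4
        + 2 * ρ * c * ‖iterate f ξ η θ₀ k ω - θs‖ ^ 2 + 0 * ‖iterate f ξ η θ₀ k ω - θs‖ ^ 2
        = (ρ * ‖iterate f ξ η θ₀ k ω - θs‖ ^ 2 + c) ^ 2 := fun ω => by ring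
    simp only [e5, integral_const_mul] at hcomb
    obtain ⟨hcomb1, hcomb2⟩ := hcomb
    have hjen := sq_integral_le P hi2 (by simpa only [← e4] using ih1)
    simp only [← e4] at hjen
    have hI0 : 0 ≤ ∫ ω, ‖iterate f ξ η θ₀ k ω - θs‖ ^ 4 ∂P :=
      integral_nonneg fun ω => by positivity
    have hjen' := Real.le_sqrt_of_sq_le hjen
    have hbound : ∫ ω, (ρ * ‖iterate f ξ η θ₀ k ω - θs‖ ^ 2 + c) ^ 2 ∂P
        ≤ (ρ * √(∫ ω, ‖iterate f ξ η θ₀ k ω - θs‖ ^ 4 ∂P) + c) ^ 2 := by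
      have h1 := mul_le_mul_of_nonneg_left hjen' (show 0 ≤ 2 * ρ * c by positivity)
      rw [hcomb2, add_sq, mul_pow, Real.sq_sqrt hI0]
      linarith
    rw [← ofReal_integral_eq_lintegral_ofReal hcomb1 (ae_of_all _ fun ω => sq_nonneg _)] at hkey
    have hint : Integrable (fun ω => ‖iterate f ξ η θ₀ (k + 1) ω - θs‖ ^ 4) P := by
      refine ⟨((hm (k + 1)).norm.pow_const 4).aestronglyMeasurable, ?_⟩
      rw [hasFiniteIntegral_iff_ofReal (ae_of_all _ fun ω => by positivity)]
      exact hkey.trans_lt ENNReal.ofReal_lt_top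
    refine ⟨hint, ?_⟩
    rw [← ofReal_integral_eq_lintegral_ofReal hint (ae_of_all _ fun ω => by positivity),
      ENNReal.ofReal_le_ofReal_iff (integral_nonneg fun ω => sq_nonneg _)] at hkey
    refine (Real.sqrt_le_iff.2 ⟨by positivity, hkey.trans hbound⟩).trans ?_
    have := mul_le_mul_of_nonneg_left ih2 hρ0
    rw [hc_eq, pow_succ]
    linarith

end Iterates

/-- A Foster–Lyapunov drift condition bounds the moment of every invariant probability measure,
without assuming that this moment is finite. -/
lemma lintegral_le_of_drift {E : Type*} [MeasurableSpace E] {π : Measure E}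
    [IsProbabilityMeasure π] {K : E → Measure E} (hK : Measurable K)
    (hprob : ∀ θ, IsProbabilityMeasure (K θ)) (hinv : π.bind K = π) {U : E → ℝ}
    (hU : Measurable U) (hU0 : ∀ θ, 0 ≤ U θ) {ρ D : ℝ} (hρ0 : 0 ≤ ρ) (hρ1 : ρ < 1) (hD : 0 ≤ D)
    (hdrift : ∀ θ, Integrable U (K θ) ∧ ∫ t, U t ∂(K θ) ≤ ρ * U θ + (1 - ρ) * D) :
    ∫⁻ θ, ENNReal.ofReal (U θ) ∂π ≤ ENNReal.ofReal D := by
  set h : ℕ → ℕ → E → ENNReal := fun n k θ =>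
    min (n : ENNReal) (ENNReal.ofReal (ρ ^ k * U θ + (1 - ρ ^ k) * D)) with hh
  have hmeas : ∀ n k, Measurable (h n k) := fun n k =>
    measurable_const.min ((hU.const_mul _).add_const _).ennreal_ofReal
  have hpow : ∀ k, 0 ≤ (1 - ρ ^ k) * D := fun k =>
    mul_nonneg (sub_nonneg.2 (pow_le_one₀ hρ0 hρ1.le)) hD
  have hstep : ∀ n k, ∫⁻ θ, h n k θ ∂π ≤ ∫⁻ θ, h n (k + 1) θ ∂π := by
    intro n k
    nth_rewrite 1 [← hinv]
    rw [Measure.lintegral_bind hK.aemeasurable (hmeas n k).aemeasurable]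
    refine lintegral_mono fun θ => le_min ?_ ?_
    · calc ∫⁻ t, h n k t ∂(K θ) ≤ ∫⁻ _, (n : ENNReal) ∂(K θ) :=
          lintegral_mono fun t => min_le_left _ _
        _ = n := by simp
    · obtain ⟨h1, h2⟩ := hdrift θ
      have hint : Integrable (fun t => ρ ^ k * U t + (1 - ρ ^ k) * D) (K θ) :=
        (h1.const_mul _).add (integrable_const _)
      calc ∫⁻ t, h n k t ∂(K θ)
          ≤ ∫⁻ t, ENNReal.ofReal (ρ ^ k * U t + (1 - ρ ^ k) * D) ∂(K θ) :=
            lintegral_mono fun t => min_le_right _ _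
        _ = ENNReal.ofReal (∫ t, (ρ ^ k * U t + (1 - ρ ^ k) * D) ∂(K θ)) :=
            (ofReal_integral_eq_lintegral_ofReal hint (ae_of_all _ fun t =>
              add_nonneg (mul_nonneg (pow_nonneg hρ0 k) (hU0 t)) (hpow k))).symm
        _ ≤ _ := by
            refine ENNReal.ofReal_le_ofReal ?_
            rw [integral_add (h1.const_mul _) (integrable_const _), integral_const_mul,
              integral_const, probReal_univ, one_smul, pow_succ]
            linarith [mul_le_mul_of_nonneg_left h2 (pow_nonneg hρ0 k)]
  have hlim : ∀ n, Filter.Tendsto (fun k => ∫⁻ θ, h n k θ ∂π) Filter.atTop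
      (nhds (∫⁻ _, min (n : ENNReal) (ENNReal.ofReal D) ∂π)) := by
    intro n
    refine tendsto_lintegral_of_dominated_convergence (fun _ => (n : ENNReal)) (hmeas n)
      (fun k => ae_of_all _ fun θ => min_le_left _ _) (by simp) (ae_of_all _ fun θ => ?_)
    refine tendsto_const_nhds.min (ENNReal.tendsto_ofReal ?_)
    have hp := tendsto_pow_atTop_nhds_zero_of_lt_one hρ0 hρ1
    simpa using (hp.mul_const (U θ)).add ((hp.const_sub 1).mul_const D)
  have hbound : ∀ n, ∫⁻ θ, h n 0 θ ∂π ≤ ENNReal.ofReal D := fun n => by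
    refine ((monotone_nat_of_le_succ (hstep n)).ge_of_tendsto (hlim n) 0).trans ?_
    simp
  have hsup : ∀ θ, ENNReal.ofReal (U θ) = ⨆ n, h n 0 θ := fun θ => by
    simp only [hh, pow_zero, one_mul, sub_self, zero_mul, add_zero]
    rw [← iSup_inf_eq, ENNReal.iSup_natCast, top_inf_eq]
  rw [lintegral_congr hsup, lintegral_iSup (fun n => hmeas n 0)]
  · exact iSup_le hbound
  · exact fun a b hab θ => min_le_min_right _ (by exact_mod_cast hab)

/-- A second-moment bound controls the bias of Lipschitz observables. -/
lemma abs_integral_sub_le_of_lipschitz {E : Type*} [NormedAddCommGroup E] [MeasurableSpace E]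
    [BorelSpace E] {π : Measure E} [IsProbabilityMeasure π] {θs : E} {D : ℝ}
    (hm : Measurable fun θ : E => ‖θ - θs‖) (hD : 0 ≤ D)
    (h : ∫⁻ θ, ENNReal.ofReal (‖θ - θs‖ ^ 2) ∂π ≤ ENNReal.ofReal D) {Lφ : NNReal} {φ : E → ℝ}
    (hφ : LipschitzWith Lφ φ) :
    Integrable φ π ∧ |(∫ θ, φ θ ∂π) - φ θs| ≤ (Lφ : ℝ) * √D := by
  have hint2 : Integrable (fun θ => ‖θ - θs‖ ^ 2) π := by
    refine ⟨(hm.pow_const 2).aestronglyMeasurable, ?_⟩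
    rw [hasFiniteIntegral_iff_ofReal (ae_of_all _ fun θ => sq_nonneg _)]
    exact h.trans_lt ENNReal.ofReal_lt_top
  have hint1 : Integrable (fun θ => ‖θ - θs‖) π :=
    ((memLp_two_iff_integrable_sq hm.aestronglyMeasurable).2 hint2).integrable one_le_two
  rw [← ofReal_integral_eq_lintegral_ofReal hint2 (ae_of_all _ fun θ => sq_nonneg _),
    ENNReal.ofReal_le_ofReal_iff hD] at h
  have hmean : ∫ θ, ‖θ - θs‖ ∂π ≤ √D :=
    Real.le_sqrt_of_sq_le ((sq_integral_le π hint1 hint2).trans h)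
  have hpt : ∀ θ, ‖φ θ - φ θs‖ ≤ Lφ * ‖θ - θs‖ := fun θ => hφ.norm_sub_le θ θs
  have hdiff : Integrable (fun θ => φ θ - φ θs) π :=
    (hint1.const_mul (Lφ : ℝ)).mono' (hφ.continuous.measurable.sub_const _).aestronglyMeasurable
      (ae_of_all _ hpt)
  have hint : Integrable φ π :=
    (hdiff.add (integrable_const (φ θs))).congr (ae_of_all _ fun θ => sub_add_cancel _ _)
  refine ⟨hint, ?_⟩
  have e : (∫ θ, φ θ ∂π) - φ θs = ∫ θ, (φ θ - φ θs) ∂π := by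
    rw [integral_sub hint (integrable_const _), integral_const, probReal_univ, one_smul]
  rw [e, ← Real.norm_eq_abs]
  refine (norm_integral_le_of_norm_le (hint1.const_mul (Lφ : ℝ)) (ae_of_all _ hpt)).trans ?_
  rw [integral_const_mul]
  exact mul_le_mul_of_nonneg_left hmean Lφ.2

section Stationary

variable {d : ℕ} {Ω : Type*} [mΩ : MeasurableSpace Ω] {P : Measure Ω}

lemma IIDRandomFields.measurable_uncurry {ξ : ℕ → Ω → Param d → Param d}
    (hξ : IIDRandomFields P ξ) (k : ℕ) : Measurable (fun p : Ω × Param d => ξ k p.1 p.2) := by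
  obtain ⟨𝒢, h𝒢, -, hmeas⟩ := hξ.indep
  exact (hmeas k).mono (sup_le_sup_right (MeasurableSpace.comap_mono (h𝒢 k)) _) le_rfl

lemma measurable_update {f : Param d → ℝ} {ξ : ℕ → Ω → Param d → Param d}
    (hξ : IIDRandomFields P ξ) (η : ℝ) :
    Measurable (fun p : Param d × Ω => p.1 - η • (gradient f p.1 + ξ 0 p.2 p.1)) :=
  measurable_fst.sub ((((measurable_gradient f).comp measurable_fst).add
    ((hξ.measurable_uncurry 0).comp measurable_swap)).const_smul η)

variable [IsProbabilityMeasure P]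

lemma measurable_transition {f : Param d → ℝ} {ξ : ℕ → Ω → Param d → Param d}
    (hξ : IIDRandomFields P ξ) (η : ℝ) : Measurable (transition P f ξ η) := by
  have hF := measurable_update (f := f) hξ η
  refine Measure.measurable_of_measurable_coe _ fun s hs => ?_
  have e : ∀ θ, transition P f ξ η θ s
      = P (Prod.mk θ ⁻¹' ((fun p : Param d × Ω =>
          p.1 - η • (gradient f p.1 + ξ 0 p.2 p.1)) ⁻¹' s)) := fun θ =>
    Measure.map_apply (hF.comp measurable_prodMk_left) hs
  simp only [e]
  exact measurable_measure_prodMk_left (hF hs)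

lemma lintegral_stationary_le {f : Param d → ℝ} {ξ : ℕ → Ω → Param d → Param d}
    (hξ : IIDRandomFields P ξ) {η ρ D : ℝ} {θs : Param d} (hρ0 : 0 ≤ ρ) (hρ1 : ρ < 1) (hD : 0 ≤ D)
    (hone : ∀ θ, Integrable (fun ω => ‖θ - η • (gradient f θ + ξ 0 ω θ) - θs‖ ^ 4) P ∧
      ∫ ω, ‖θ - η • (gradient f θ + ξ 0 ω θ) - θs‖ ^ 4 ∂P ≤
        (ρ * ‖θ - θs‖ ^ 2 + (1 - ρ) * D) ^ 2) {π : Measure (Param d)}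
    (hπ : IsStationary P f ξ η π) :
    ∫⁻ θ, ENNReal.ofReal (‖θ - θs‖ ^ 2) ∂π ≤ ENNReal.ofReal D := by
  have := hπ.prob
  have hK := measurable_transition (f := f) hξ η
  have hF : ∀ θ, Measurable (fun ω => θ - η • (gradient f θ + ξ 0 ω θ)) := fun θ =>
    (measurable_update (f := f) hξ η).comp measurable_prodMk_left
  have hU : Measurable (fun θ : Param d => ‖θ - θs‖ ^ 2) :=
    (measurable_id.sub_const θs).norm.pow_const 2
  refine lintegral_le_of_drift hK (fun θ => Measure.isProbabilityMeasure_map (hF θ).aemeasurable)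
    (Measure.ext fun s hs => ?_) hU (fun θ => sq_nonneg _) hρ0 hρ1 hD fun θ => ?_
  · rw [Measure.bind_apply hs hK.aemeasurable, hπ.invariant s hs]
  · obtain ⟨h4, hle⟩ := hone θ
    have e4 : ∀ x : Param d, ‖x‖ ^ 4 = (‖x‖ ^ 2) ^ 2 := fun x => by ring
    simp only [e4] at h4 hle
    have hi2 : Integrable (fun ω => ‖θ - η • (gradient f θ + ξ 0 ω θ) - θs‖ ^ 2) P :=
      ((memLp_two_iff_integrable_sq (hU.comp (hF θ)).aestronglyMeasurable).2 h4).integrable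
        one_le_two
    unfold transition
    rw [integrable_map_measure hU.aestronglyMeasurable (hF θ).aemeasurable,
      integral_map (hF θ).aemeasurable hU.aestronglyMeasurable]
    refine ⟨hi2, abs_le_of_sq_le_sq' ((sq_integral_le P hi2 h4).trans hle) ?_ |>.2⟩
    exact add_nonneg (mul_nonneg hρ0 (sq_nonneg _)) (mul_nonneg (sub_nonneg.2 hρ1.le) hD)

end Stationary

end SGD

theorem proposition2 {d : ℕ} {Ω : Type*} [MeasurableSpace Ω]
    (P : Measure Ω) [IsProbabilityMeasure P]
    (f : SGD.Param d → ℝ) (hf : Differentiable ℝ f)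
    (ξ : ℕ → Ω → SGD.Param d → SGD.Param d)
    (L α β Lξ : ℝ)
    (hgrowth : SGD.LinearGrowth f L)
    (hdiss : SGD.Dissipative f α β)
    (hnoise : SGD.NoiseAssumptionFour P ξ Lξ)
    (θs : SGD.Param d) (hcrit : gradient f θs = 0)
    (η : ℝ) (hη : 0 < η)
    (hη_lt : η < min (min (min 1 (1 / (10 * SGD.Lbar L ‖θs‖))) (SGD.cL α L Lξ))
      (SGD.cDagger α β L Lξ ‖θs‖)) :
    SGD.rate α β L Lξ ‖θs‖ η ∈ Set.Ioo (0 : ℝ) 1 ∧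
    (∀ (θ₀ : SGD.Param d) (k : ℕ),
      Integrable (fun ω => ‖SGD.iterate f ξ η θ₀ k ω - θs‖ ^ 4) P ∧
      Real.sqrt (∫ ω, ‖SGD.iterate f ξ η θ₀ k ω - θs‖ ^ 4 ∂P)
        ≤ SGD.rate α β L Lξ ‖θs‖ η ^ k * ‖θ₀ - θs‖ ^ 2 + SGD.constD α β L Lξ ‖θs‖) ∧
    (∀ π : Measure (SGD.Param d), SGD.IsStationary P f ξ η π →
      ∀ (Lφ : NNReal) (φ : SGD.Param d → ℝ), LipschitzWith Lφ φ →
        Integrable φ π ∧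
        |(∫ θ, φ θ ∂π) - φ θs| ≤ (Lφ : ℝ) * Real.sqrt (SGD.constD α β L Lξ ‖θs‖)) := by
  simp only [lt_min_iff] at hη_lt
  obtain ⟨⟨⟨hη1, hηL⟩, -⟩, hηc⟩ := hη_lt
  have hα := hdiss.1
  have hηL' : η * SGD.Lbar L ‖θs‖ ≤ 1 / 10 := by
    have hL0 : 0 < SGD.Lbar L ‖θs‖ := by
      by_contra h
      have : 1 / (10 * SGD.Lbar L ‖θs‖) ≤ 0 :=
        div_nonpos_of_nonneg_of_nonpos zero_le_one (by linarith)
      linarith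
    rw [lt_div_iff₀ (by positivity)] at hηL
    linarith
  obtain ⟨-, hρlow, hρup⟩ := SGD.rate_bounds (L := L) (β := β) (r := ‖θs‖) hα hnoise.pos hη hηc
  have hone := SGD.one_step hgrowth hdiss hnoise hcrit hη hη1 hηL' hηc
  have hD := SGD.constD_nonneg α β L Lξ ‖θs‖ hα
  have hρ0 : 0 < SGD.rate α β L Lξ ‖θs‖ η := by linarith
  have hρ1 : SGD.rate α β L Lξ ‖θs‖ η < 1 := by
    have : 0 < 3 / 4 * α * η := by positivity
    linarith
  refine ⟨⟨hρ0, hρ1⟩, fun θ₀ k => ?_, fun π hπ Lφ φ hφ => ?_⟩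
  · obtain ⟨h1, h2⟩ := SGD.iterate_fourth_moment hnoise.iid hρ0.le hρ1.le hD hone θ₀ k
    refine ⟨h1, h2.trans ?_⟩
    linarith [mul_nonneg (pow_nonneg hρ0.le k) hD]
  · have := hπ.prob
    exact SGD.abs_integral_sub_le_of_lipschitz (measurable_id.sub_const θs).norm hD
      (SGD.lintegral_stationary_le hnoise.iid hρ0.le hρ1 hD hone hπ) hφ
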